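/- Let $n\ge 1$ and consider the following probabilistic program $s$ over the variables $d$ (an integer), $c,f,l\in\mathbb Z/n\mathbb Z$ and $ret\in(\mathbb Z/n\mathbb Z)^2$, where the arithmetic on $c,f,l$ is modulo $n$ and $\mathcal U_{\{-1,1\}}$ is the uniform distribution on the set of integers $\{-1,1\}$: $$\begin{array}{l} d\leftarrow 0;\ c\leftarrow 0;\ f\leftarrow 0;\ l\leftarrow 0;\\ \textbf{while } l+1\neq f \textbf{ do}\\ \quad d \xleftarrow{\$} \mathcal U_{\{-1,1\}};\\ \quad \textbf{if } c=l\wedge d=1 \textbf{ then } l\leftarrow l+1;\\ \quad \textbf{if } c=f\wedge d=-1 \textbf{ then } f\leftarrow f-1;\\ \quad c\leftarrow c+d;\\ ret\leftarrow (l,l+1) \end{array}$$ It runs a simple random walk $c$ on the $n$-cycle, started at $0$, and keeps track of the range $[f,l]$ of visited nodes, until all nodes are visited; then $(l,l+1)$ is the only arc that has not been visited. For a state $m$, let $[\![s]\!]_m$ be the sub-distribution of final states of $s$ started in $m$ (denotational semantics, a loop being the limit of its finite unrollings). Then: 1. for all $a,b\in\mathbb Z/n\mathbb Z$, the probabilistic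 relational Hoare judgment $$\models s\sim s:\ \top\Longrightarrow \big(ret\langle1\rangle=(a,a+1)\iff ret\langle2\rangle=(b,b+1)\big)$$ is valid, that is, for all initial states $m_1,m_2$ there is a sub-distribution on pairs of states whose marginals are $[\![s]\!]_{m_1}$ and $[\![s]\!]_{m_2}$ and whose support is contained in the set of pairs $(m_1',m_2')$ with $m_1'(ret)=(a,a+1)\iff m_2'(ret)=(b,b+1)$; 2. $s$ is lossless, that is, from every initial state it terminates with probability $1$; 3. the returned arc is uniformly distributed over the $n$ arcs of the cycle: for every initial state $m$ and every $a\in\mathbb Z/n\mathbb Z$, $$\Pr_{[\![s]\!]_m}\big[ret=(a,a+1)\big]=\frac1n .$$ -/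

import Mathlib

open scoped ENNReal
open Filter Topology

noncomputable section

namespace PWhile

/-! ### Discrete sub-distributions -/

/-- A discrete sub-distribution over `A`: a mass function of total weight at most `1`. -/
@[ext]
structure SubDist (A : Type*) where
  mass : A → ℝ≥0∞
  tsum_mass_le_one : ∑' a, mass a ≤ 1

namespace SubDist

variable {A B : Type*}

/-- The weight of a sub-distribution. -/
def weight (μ : SubDist A) : ℝ≥0∞ := ∑' a, μ.mass a

/-- The probability of an event. -/
def pr (μ : SubDist A) (E : A → Prop) : ℝ≥0∞ := ∑' x : {x : A // E x}, μ.mass x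

/-- The null sub-distribution. -/
def null : SubDist A := ⟨fun _ => 0, by simp⟩

/-- A (weight one) distribution, seen as a sub-distribution. -/
def ofPMF (p : PMF A) : SubDist A := ⟨fun a => p a, p.tsum_coe.le⟩

/-- The Dirac distribution at `a`. -/
def dirac (a : A) : SubDist A := ofPMF (PMF.pure a)

/-- The expectation (monadic bind) `x ↦ ∑ a, μ a * M a x`. -/
def bind (μ : SubDist A) (M : A → SubDist B) : SubDist B :=
  ⟨fun b => ∑' a, μ.mass a * (M a).mass b, by
    rw [ENNReal.tsum_comm]
    calc ∑' a, ∑' b, μ.mass a * (M a).mass b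
        = ∑' a, μ.mass a * ∑' b, (M a).mass b := by simp_rw [ENNReal.tsum_mul_left]
      _ ≤ ∑' a, μ.mass a * 1 :=
          ENNReal.tsum_le_tsum fun a => mul_le_mul_right (M a).tsum_mass_le_one _
      _ ≤ 1 := by simpa using μ.tsum_mass_le_one⟩

/-- The first marginal of a sub-distribution over pairs. -/
def fst (μ : SubDist (A × B)) : SubDist A :=
  ⟨fun a => ∑' b, μ.mass (a, b), by
    rw [← ENNReal.tsum_prod]; exact μ.tsum_mass_le_one⟩

/-- The second marginal of a sub-distribution over pairs. -/
def snd (μ : SubDist (A × B)) : SubDist B :=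
  ⟨fun b => ∑' a, μ.mass (a, b), by
    rw [ENNReal.tsum_comm, ← ENNReal.tsum_prod]; exact μ.tsum_mass_le_one⟩

/-- Existence of a `Ψ`-coupling of `μ₁` and `μ₂`. -/
def Coupled (μ₁ : SubDist A) (μ₂ : SubDist B) (Ψ : A → B → Prop) : Prop :=
  ∃ μ : SubDist (A × B), μ.fst = μ₁ ∧ μ.snd = μ₂ ∧ ∀ a b, μ.mass (a, b) ≠ 0 → Ψ a b

/-- The limit of a pointwise nondecreasing sequence of sub-distributions. -/
def limit (μ : ℕ → SubDist A) (h : ∀ a, Monotone fun n => (μ n).mass a) : SubDist A :=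
  ⟨fun a => ⨆ n, (μ n).mass a, by
    rw [ENNReal.tsum_eq_iSup_sum]
    refine iSup_le fun s => ?_
    rw [ENNReal.finsetSum_iSup_of_monotone h]
    exact iSup_le fun n => (ENNReal.sum_le_tsum s).trans (μ n).tsum_mass_le_one⟩

theorem tendsto_limit (μ : ℕ → SubDist A) (h : ∀ a, Monotone fun n => (μ n).mass a) (a : A) :
    Tendsto (fun n => (μ n).mass a) atTop (𝓝 ((limit μ h).mass a)) :=
  tendsto_atTop_iSup (h a)

end SubDist

/-! ### Semantics of loops -/

section Loop

variable {S : Type*}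

/-- The denotation of `if b then s`, where `k` is the denotation of `s`. -/
def guarded (b : S → Bool) (k : S → SubDist S) (m : S) : SubDist S :=
  if b m then k m else SubDist.dirac m

/-- The denotation of the `i`-fold sequence `(if b then s)^i`. -/
def guardedIter (b : S → Bool) (k : S → SubDist S) : ℕ → S → SubDist S
  | 0, m => SubDist.dirac m
  | i + 1, m => (guardedIter b k i m).bind (guarded b k)

/-- The denotation of `(if b then s)^i; if b then abort`. -/
def loopApprox (b : S → Bool) (k : S → SubDist S) (i : ℕ) (m : S) : SubDist S :=
  (guardedIter b k i m).bind (guarded b fun _ => SubDist.null)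

theorem loopApprox_mass (b : S → Bool) (k : S → SubDist S) (i : ℕ) (m m' : S) :
    (loopApprox b k i m).mass m' = if b m' then 0 else (guardedIter b k i m).mass m' := by
  classical
  have key : ∀ x, (guardedIter b k i m).mass x *
      (guarded b (fun _ => SubDist.null) x).mass m' =
      if x = m' then (if b m' then 0 else (guardedIter b k i m).mass m') else 0 := by
    intro x
    by_cases hx : x = m'
    · subst hx
      by_cases hb : b x <;> simp [guarded, hb, SubDist.null, SubDist.dirac, SubDist.ofPMF]
    · have hx' : m' ≠ x := fun h => hx h.symm
      by_cases hb : b x <;>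
        simp [guarded, hb, SubDist.null, SubDist.dirac, SubDist.ofPMF, hx, hx']
  change ∑' x, (guardedIter b k i m).mass x *
      (guarded b (fun _ => SubDist.null) x).mass m' = _
  simp_rw [key]
  exact tsum_ite_eq m' _

theorem loopApprox_mono (b : S → Bool) (k : S → SubDist S) (m m' : S) :
    Monotone fun i => (loopApprox b k i m).mass m' := by
  refine monotone_nat_of_le_succ fun i => ?_
  rw [loopApprox_mass, loopApprox_mass]
  by_cases hb : b m'
  · simp [hb]
  · simp only [hb]
    have h : (guardedIter b k i m).mass m' * (guarded b k m').mass m' ≤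
        (guardedIter b k (i + 1) m).mass m' :=
      ENNReal.le_tsum (f := fun x => (guardedIter b k i m).mass x * (guarded b k x).mass m') m'
    simpa [guarded, hb, SubDist.dirac, SubDist.ofPMF] using h

/-- The denotation of `while b do s`: the limit of the denotations of
`(if b then s)^i; if b then abort` as `i → ∞`. -/
def loop (b : S → Bool) (k : S → SubDist S) (m : S) : SubDist S :=
  SubDist.limit (fun i => loopApprox b k i m) (loopApprox_mono b k m)

end Loop

/-! ### The programming language -/

/-- A state is a type-preserving mapping from variables to values. -/
abbrev State {X : Type} (T : X → Type) : Type := (x : X) → T x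

/-- Statements over the typed variables `X`, `T`. Expressions and distribution expressions
are represented by their interpretations as functions of the state. -/
inductive Stmt {X : Type} (T : X → Type) : Type
  | skip : Stmt T
  | abort : Stmt T
  | assign (x : X) (e : State T → T x) : Stmt T
  | sample (x : X) (g : State T → PMF (T x)) : Stmt T
  | seq (s₁ s₂ : Stmt T) : Stmt T
  | cond (e : State T → Bool) (s₁ s₂ : Stmt T) : Stmt T
  | while (e : State T → Bool) (s : Stmt T) : Stmt T

variable {X : Type} {T : X → Type}

/-- Sequential composition. -/
scoped infixr:60 " ;; " => Stmt.seq

/-- The denotational semantics of statements. -/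
def Stmt.sem [DecidableEq X] : Stmt T → State T → SubDist (State T)
  | .skip, m => SubDist.dirac m
  | .abort, _ => SubDist.null
  | .assign x e, m => SubDist.dirac (Function.update m x (e m))
  | .sample x g, m =>
      (SubDist.ofPMF (g m)).bind fun v => SubDist.dirac (Function.update m x v)
  | .seq s₁ s₂, m => (s₁.sem m).bind s₂.sem
  | .cond e s₁ s₂, m => if e m then s₁.sem m else s₂.sem m
  | .while e s, m => loop e s.sem m

/-- A program is lossless if it terminates with probability one from every initial state. -/
def Stmt.Lossless [DecidableEq X] (s : Stmt T) : Prop :=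
  ∀ m : State T, (s.sem m).weight = 1

/-- Validity of the probabilistic relational Hoare judgment `s₁ ~ s₂ : φ ⇒ ψ`. -/
def ValidJudgment [DecidableEq X] (s₁ s₂ : Stmt T) (φ ψ : State T → State T → Prop) : Prop :=
  ∀ m₁ m₂ : State T, φ m₁ m₂ → SubDist.Coupled (s₁.sem m₁) (s₂.sem m₂) ψ

end PWhile

/-! ### The cyclic random walk -/

namespace CyclicWalk

open PWhile

/-- The program variables. -/
inductive Var : Type
  | d | c | f | l | ret
  deriving DecidableEq

/-- The types of the variables: the coin `d` is an integer, the nodes `c`, `f`, `l` are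
integers modulo `n`, and `ret` is a pair of nodes. -/
abbrev Ty (n : ℕ) : Var → Type
  | .d => ℤ
  | .c => ZMod n
  | .f => ZMod n
  | .l => ZMod n
  | .ret => ZMod n × ZMod n

/-- The uniform distribution over `{-1, 1}`. -/
def fairSign : PMF ℤ := PMF.uniformOfFinset {-1, 1} (by simp)

/-- The loop body: one step of the walk, with the update of the visited range `[f, l]`. -/
def body (n : ℕ) : Stmt (Ty n) :=
  .sample .d (fun _ => fairSign) ;;
  .cond (fun m => decide (m .c = m .l ∧ m .d = 1)) (.assign .l fun m => m .l + 1) .skip ;;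
  .cond (fun m => decide (m .c = m .f ∧ m .d = -1)) (.assign .f fun m => m .f - 1) .skip ;;
  .assign .c (fun m => m .c + (m .d : ZMod n))

/-- The cyclic random walk over the `n` nodes of `ℤ/nℤ`. The loop runs until `l + 1 = f`,
that is, until every node has been visited. -/
def walk (n : ℕ) : Stmt (Ty n) :=
  .assign .d (fun _ => (0 : ℤ)) ;;
  .assign .c (fun _ => (0 : ZMod n)) ;;
  .assign .f (fun _ => (0 : ZMod n)) ;;
  .assign .l (fun _ => (0 : ZMod n)) ;;
  .while (fun m => decide (m .l + 1 ≠ m .f)) (body n) ;;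
  .assign .ret (fun m => (m .l, m .l + 1))

end CyclicWalk

end

namespace PWhile

namespace SubDist

variable {A B : Type*}

/-- The expectation of a nonnegative function under a sub-distribution. -/
noncomputable def expect (μ : SubDist A) (g : A → ℝ≥0∞) : ℝ≥0∞ := ∑' a, μ.mass a * g a

theorem expect_dirac (a : A) (g : A → ℝ≥0∞) : (dirac a).expect g = g a := by
  classical
  simp [expect, dirac, ofPMF, PMF.pure_apply]

theorem expect_bind (μ : SubDist A) (M : A → SubDist B) (g : B → ℝ≥0∞) :
    (μ.bind M).expect g = μ.expect fun a => (M a).expect g := by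
  simp only [expect, bind, ← ENNReal.tsum_mul_right, ← ENNReal.tsum_mul_left]
  rw [ENNReal.tsum_comm]
  simp only [mul_assoc]

theorem expect_one (μ : SubDist A) : μ.expect (fun _ => 1) = μ.weight := by
  simp [expect, weight]

theorem expect_mono (μ : SubDist A) {g h : A → ℝ≥0∞} (H : ∀ a, g a ≤ h a) :
    μ.expect g ≤ μ.expect h :=
  ENNReal.tsum_le_tsum fun a => mul_le_mul_right (H a) _

theorem expect_le_one (μ : SubDist A) {g : A → ℝ≥0∞} (hg : ∀ a, g a ≤ 1) :
    μ.expect g ≤ 1 :=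
  (μ.expect_mono hg).trans (by rw [expect_one]; exact μ.tsum_mass_le_one)

theorem expect_le_expect_limit (μ : ℕ → SubDist A) (h : ∀ a, Monotone fun n => (μ n).mass a)
    (g : A → ℝ≥0∞) (i : ℕ) : (μ i).expect g ≤ (limit μ h).expect g :=
  ENNReal.tsum_le_tsum fun a => mul_le_mul_left (le_iSup (fun n => (μ n).mass a) i) _

open Classical in
theorem pr_eq_expect (μ : SubDist A) (E : A → Prop) :
    μ.pr E = μ.expect fun a => if E a then 1 else 0 := by
  have h := tsum_subtype {a | E a} μ.mass
  simp only [pr, expect]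
  refine h.trans (tsum_congr fun a => ?_)
  by_cases ha : E a <;> simp [ha]

theorem pr_add_pr_not (μ : SubDist A) (E : A → Prop) :
    μ.pr E + μ.pr (fun a => ¬ E a) = μ.weight := by
  classical
  rw [pr_eq_expect, pr_eq_expect, expect, expect, ← ENNReal.tsum_add, weight]
  refine tsum_congr fun a => ?_
  by_cases ha : E a <;> simp [ha]

theorem mass_le_pr (μ : SubDist A) {E : A → Prop} {a : A} (ha : E a) : μ.mass a ≤ μ.pr E :=
  ENNReal.le_tsum (f := fun x : {x : A // E x} => μ.mass x) ⟨a, ha⟩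

theorem pr_ne_top (μ : SubDist A) (E : A → Prop) : μ.pr E ≠ ⊤ := by
  classical
  rw [pr_eq_expect]
  refine ((μ.expect_le_one fun a => ?_).trans_lt ENNReal.one_lt_top).ne
  split_ifs <;> simp

open Classical in
/-- The mass function of the coupling that is a product inside each of the classes
`P ∧ Q` and `¬ P ∧ ¬ Q`. -/
noncomputable def iffMass (μ₁ : SubDist A) (μ₂ : SubDist B) (P : A → Prop) (Q : B → Prop) (x : A) (y : B) :
    ℝ≥0∞ :=
  if P x then if Q y then μ₁.mass x * μ₂.mass y * (μ₁.pr P)⁻¹ else 0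
  else if Q y then 0 else μ₁.mass x * μ₂.mass y * (μ₁.pr fun a => ¬ P a)⁻¹

theorem iffMass_swap (μ₁ : SubDist A) (μ₂ : SubDist B) (P : A → Prop) (Q : B → Prop)
    (h : μ₁.pr P = μ₂.pr Q) (h' : μ₁.pr (fun a => ¬ P a) = μ₂.pr fun b => ¬ Q b) (x : A) (y : B) :
    iffMass μ₁ μ₂ P Q x y = iffMass μ₂ μ₁ Q P y x := by
  unfold iffMass
  rw [h, h', mul_comm (μ₁.mass x)]
  split_ifs <;> rfl

theorem tsum_iffMass (μ₁ : SubDist A) (μ₂ : SubDist B) (P : A → Prop) (Q : B → Prop)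
    (h : μ₁.pr P = μ₂.pr Q) (h' : μ₁.pr (fun a => ¬ P a) = μ₂.pr fun b => ¬ Q b) (x : A) :
    ∑' y, iffMass μ₁ μ₂ P Q x y = μ₁.mass x := by
  classical
  have cancel : ∀ (E : A → Prop), E x → μ₁.mass x * (μ₁.pr E)⁻¹ * μ₁.pr E = μ₁.mass x := by
    intro E hx
    by_cases h0 : μ₁.pr E = 0
    · have : μ₁.mass x = 0 := le_antisymm ((μ₁.mass_le_pr hx).trans h0.le) bot_le
      simp [this]
    · rw [mul_assoc, ENNReal.inv_mul_cancel h0 (μ₁.pr_ne_top E), mul_one]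
  by_cases hx : P x
  · conv_rhs => rw [← cancel P hx]
    nth_rewrite 2 [h]
    rw [pr_eq_expect μ₂, expect, ← ENNReal.tsum_mul_left]
    refine tsum_congr fun y => ?_
    by_cases hy : Q y
    · simp only [iffMass, hx, hy, if_true]; ring
    · simp [iffMass, hx, hy]
  · conv_rhs => rw [← cancel (fun a => ¬ P a) hx]
    nth_rewrite 2 [h']
    rw [pr_eq_expect μ₂, expect, ← ENNReal.tsum_mul_left]
    refine tsum_congr fun y => ?_
    by_cases hy : Q y
    · simp [iffMass, hx, hy]
    · simp only [iffMass, hx, hy, if_false, not_false_eq_true, if_true]; ring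

/-- Lossless sub-distributions giving the same probability to `P` and `Q` are coupled by
`P ↔ Q`. -/
theorem coupled_iff_of_pr_eq (μ₁ : SubDist A) (μ₂ : SubDist B) (P : A → Prop) (Q : B → Prop)
    (h₁ : μ₁.weight = 1) (h₂ : μ₂.weight = 1) (h : μ₁.pr P = μ₂.pr Q) :
    Coupled μ₁ μ₂ fun x y => P x ↔ Q y := by
  classical
  have h' : μ₁.pr (fun a => ¬ P a) = μ₂.pr fun b => ¬ Q b := by
    have e := (μ₁.pr_add_pr_not P).trans (h₁.trans (h₂.symm.trans (μ₂.pr_add_pr_not Q).symm))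
    rw [h] at e
    exact (ENNReal.add_right_inj (μ₂.pr_ne_top Q)).1 e
  refine ⟨⟨fun z => iffMass μ₁ μ₂ P Q z.1 z.2, ?_⟩, ?_, ?_, fun a b hab => ?_⟩
  · rw [ENNReal.tsum_prod']
    simp only [tsum_iffMass μ₁ μ₂ P Q h h']
    exact μ₁.tsum_mass_le_one
  · ext a
    exact tsum_iffMass μ₁ μ₂ P Q h h' a
  · ext b
    refine Eq.trans (tsum_congr fun a => ?_) (tsum_iffMass μ₂ μ₁ Q P h.symm h'.symm b)
    exact iffMass_swap μ₁ μ₂ P Q h h' a b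
  · by_cases ha : P a <;> by_cases hb : Q b <;> simp_all [iffMass]

end SubDist

section Loop

variable {S : Type*} (b : S → Bool) (k : S → SubDist S)

theorem expect_guardedIter_succ (i : ℕ) (m : S) (g : S → ℝ≥0∞) :
    (guardedIter b k (i + 1) m).expect g =
      (guarded b k m).expect fun x => (guardedIter b k i x).expect g := by
  induction i generalizing g with
  | zero => simp [guardedIter, SubDist.expect_bind, SubDist.expect_dirac]
  | succ i ih =>
    rw [guardedIter, SubDist.expect_bind, ih]
    simp only [guardedIter, SubDist.expect_bind]

theorem expect_loopApprox_succ (i : ℕ) (m : S) (g : S → ℝ≥0∞) :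
    (loopApprox b k (i + 1) m).expect g =
      (guarded b k m).expect fun x => (loopApprox b k i x).expect g := by
  simp only [loopApprox, SubDist.expect_bind]
  exact expect_guardedIter_succ b k i m _

theorem expect_loopApprox_of_not {m : S} (hm : b m = false) (i : ℕ) (g : S → ℝ≥0∞) :
    (loopApprox b k i m).expect g = g m := by
  induction i with
  | zero => simp [loopApprox, guardedIter, SubDist.expect_bind, SubDist.expect_dirac, guarded, hm]
  | succ i ih =>
    rw [expect_loopApprox_succ]
    simp [guarded, hm, SubDist.expect_dirac, ih]

end Loop

end PWhile

namespace CyclicWalk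

open PWhile

variable {n : ℕ}

/-- The guard of the loop. -/
abbrev guard (n : ℕ) (m : State (Ty n)) : Bool := decide (m .l + 1 ≠ m .f)

theorem expect_fairSign (g : ℤ → ℝ≥0∞) :
    (SubDist.ofPMF fairSign).expect g = 2⁻¹ * (g 1 + g (-1)) := by
  have h : ∀ v : ℤ, (SubDist.ofPMF fairSign).mass v * g v =
      if v ∈ ({-1, 1} : Finset ℤ) then 2⁻¹ * g v else 0 := by
    intro v
    by_cases hv : v ∈ ({-1, 1} : Finset ℤ)
    · simp [SubDist.ofPMF, fairSign, PMF.uniformOfFinset_apply]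
    · simp only [SubDist.ofPMF, fairSign, PMF.uniformOfFinset_apply, hv, if_false, zero_mul]
  rw [SubDist.expect, tsum_congr h, tsum_eq_sum (s := ({-1, 1} : Finset ℤ))]
  · rw [Finset.sum_pair (by decide)]
    simp [mul_add, add_comm]
  · intro v hv
    simp [hv]

/-- The state after one execution of the loop body in which the coin shows `d`. -/
def step (m : State (Ty n)) (d : ℤ) : State (Ty n)
  | .d => d
  | .c => m .c + (d : ZMod n)
  | .f => if m .c = m .f ∧ d = -1 then m .f - 1 else m .f
  | .l => if m .c = m .l ∧ d = 1 then m .l + 1 else m .l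
  | .ret => m .ret

theorem expect_body (m : State (Ty n)) (g : State (Ty n) → ℝ≥0∞) :
    ((body n).sem m).expect g = 2⁻¹ * (g (step m 1) + g (step m (-1))) := by
  have h : ((body n).sem m).expect g =
      (SubDist.ofPMF fairSign).expect fun d => g (step m d) := by
    simp only [body, Stmt.sem, SubDist.expect_bind, SubDist.expect_dirac]
    congr 1
    funext d
    by_cases h1 : m .c = m .l ∧ d = 1 <;> by_cases h2 : m .c = m .f ∧ d = -1 <;>
      simp [SubDist.expect_dirac, h1, h2] <;> congr 1 <;> funext v <;> cases v <;>
      simp_all [step, sub_eq_add_neg]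
  rw [h, expect_fairSign]

/-- The probability that `i` unrollings of the loop terminate with `l = a`. -/
noncomputable def hitProb (a : ZMod n) (i : ℕ) (m : State (Ty n)) : ℝ :=
  ((loopApprox (guard n) (body n).sem i m).expect fun m => if m .l = a then 1 else 0).toReal

theorem hitProb_nonneg (a : ZMod n) (i : ℕ) (m : State (Ty n)) : 0 ≤ hitProb a i m :=
  ENNReal.toReal_nonneg

theorem expect_eq_ne_top (a : ZMod n) (μ : SubDist (State (Ty n))) :
    (μ.expect fun m => if m .l = a then 1 else 0) ≠ ⊤ :=
  ((μ.expect_le_one fun m => by split_ifs <;> simp).trans_lt ENNReal.one_lt_top).ne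

theorem hitProb_succ (a : ZMod n) (i : ℕ) {m : State (Ty n)} (hm : m .l + 1 ≠ m .f) :
    hitProb a (i + 1) m = (hitProb a i (step m 1) + hitProb a i (step m (-1))) / 2 := by
  have hb : guard n m = true := by simp [guard, hm]
  rw [hitProb, expect_loopApprox_succ, guarded, if_pos hb, expect_body, ENNReal.toReal_mul,
    ENNReal.toReal_add (expect_eq_ne_top a _) (expect_eq_ne_top a _)]
  simp only [hitProb, ENNReal.toReal_inv, ENNReal.toReal_ofNat]
  ring

theorem hitProb_of_final (i : ℕ) {m : State (Ty n)} (hm : m .l + 1 = m .f) :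
    hitProb (m .l) i m = 1 := by
  rw [hitProb, expect_loopApprox_of_not _ _ (by simp [guard, hm])]
  simp

/-- The integers `F ≤ C ≤ L` are lifts of the visited range and the position of the walk. -/
structure Lift (m : State (Ty n)) (F C L : ℤ) : Prop where
  f_eq : m .f = (F : ZMod n)
  c_eq : m .c = (C : ZMod n)
  l_eq : m .l = (L : ZMod n)
  f_le : F ≤ C
  le_l : C ≤ L
  lt : L - F < n

theorem intCast_eq_iff_of_lt {x y : ℤ} (h : x ≤ y) (h' : y - x < n) :
    (x : ZMod n) = (y : ZMod n) ↔ x = y := by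
  refine ⟨fun e => ?_, fun e => e ▸ rfl⟩
  rw [ZMod.intCast_eq_intCast_iff_dvd_sub] at e
  have := Int.eq_zero_of_dvd_of_nonneg_of_lt (by omega) h' e
  omega

namespace Lift

variable {m : State (Ty n)} {F C L : ℤ}

theorem final_iff (h : Lift m F C L) : m .l + 1 = m .f ↔ L + 1 = F + n := by
  have := h.f_le; have := h.le_l; have := h.lt
  rw [h.l_eq, h.f_eq]
  have e : ((F : ℤ) : ZMod n) = ((F + n : ℤ) : ZMod n) := by simp
  rw [e, ← intCast_eq_iff_of_lt (n := n) (x := L + 1) (y := F + n) (by omega) (by omega)]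
  push_cast
  rfl

theorem step_one (h : Lift m F C L) (hf : L + 1 ≠ F + n) :
    Lift (step m 1) F (C + 1) (max L (C + 1)) := by
  have h1 := h.f_le; have h2 := h.le_l; have h3 := h.lt
  refine ⟨by simp [step, h.f_eq], by simp [step, h.c_eq], ?_, by omega, by omega, by omega⟩
  have e : m .c = m .l ↔ C = L := by
    rw [h.c_eq, h.l_eq]; exact intCast_eq_iff_of_lt (by omega) (by omega)
  by_cases hc : C = L
  · subst hc; simp [step, h.c_eq, h.l_eq]
  · have : max L (C + 1) = L := by omega
    rw [this, ← h.l_eq]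
    simp [step, e, hc]

theorem step_neg_one (h : Lift m F C L) (hf : L + 1 ≠ F + n) :
    Lift (step m (-1)) (min F (C - 1)) (C - 1) L := by
  have h1 := h.f_le; have h2 := h.le_l; have h3 := h.lt
  refine ⟨?_, by simp [step, h.c_eq, sub_eq_add_neg], by simp [step, h.l_eq], by omega, by omega,
    by omega⟩
  have e : m .c = m .f ↔ F = C := by
    rw [h.c_eq, h.f_eq, eq_comm]; exact intCast_eq_iff_of_lt (by omega) (by omega)
  by_cases hc : F = C
  · subst hc; simp [step, h.c_eq, h.f_eq]
  · have : min F (C - 1) = F := by omega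
    rw [this, ← h.f_eq]
    simp [step, e, hc]

end Lift

/-- `n` times the probability that the range of the walk ends as `[A - n + 1, A]`. -/
def harm (n : ℕ) (A F C L : ℤ) : ℤ :=
  if A - n + 1 ≤ F ∧ L ≤ A then
    1 + (if L = A then L - C else 0) + (if F = A - n + 1 then C - F else 0)
  else 0

theorem harm_le {A F C L : ℤ} (h1 : F ≤ C) (h2 : C ≤ L) (h3 : L - F < n) :
    harm n A F C L ≤ n := by
  unfold harm
  split_ifs <;> omega

theorem two_mul_harm_le {A F C L : ℤ} (h1 : F ≤ C) (h2 : C ≤ L) (h3 : L + 1 < F + n) :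
    2 * harm n A F C L ≤
      harm n A F (C + 1) (max L (C + 1)) + harm n A (min F (C - 1)) (C - 1) L := by
  rcases eq_or_lt_of_le h1 with rfl | h1 <;> rcases eq_or_lt_of_le h2 with rfl | h2 <;>
    simp only [harm] <;> split_ifs <;> omega

/-- Twice the expected number of steps until every node has been visited. -/
def pot (n : ℕ) (F C L : ℤ) : ℤ :=
  n * (n + 1) - ((C - F) ^ 2 + (L - C) ^ 2 + (C - F) + (L - C))

theorem pot_nonneg {F C L : ℤ} (h1 : F ≤ C) (h2 : C ≤ L) (h3 : L - F < n) :
    0 ≤ pot n F C L := by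
  unfold pot
  nlinarith [mul_nonneg (sub_nonneg.2 h1) (sub_nonneg.2 h2)]

theorem pot_step {F C L : ℤ} (h1 : F ≤ C) (h2 : C ≤ L) :
    pot n F (C + 1) (max L (C + 1)) + pot n (min F (C - 1)) (C - 1) L + 4 =
      2 * pot n F C L := by
  have e1 : F = C ∧ min F (C - 1) = C - 1 ∨ min F (C - 1) = F := by omega
  have e2 : L = C ∧ max L (C + 1) = C + 1 ∨ max L (C + 1) = L := by omega
  unfold pot
  rcases e1 with ⟨rfl, e1⟩ | e1 <;> rcases e2 with ⟨rfl, e2⟩ | e2 <;> rw [e1, e2] <;> ring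

theorem harm_le_hitProb (A : ℤ) (i : ℕ) {m : State (Ty n)} {F C L : ℤ} (h : Lift m F C L) :
    2 * i * (harm n A F C L : ℝ) ≤
      2 * i * n * hitProb (A : ZMod n) i m + n * (pot n F C L : ℝ) := by
  induction i generalizing m F C L with
  | zero =>
    have := pot_nonneg h.f_le h.le_l h.lt
    have : (0 : ℝ) ≤ pot n F C L := by exact_mod_cast this
    simp only [Nat.cast_zero, mul_zero, zero_mul, zero_add]
    positivity
  | succ i ih =>
    have hG : (harm n A F C L : ℝ) ≤ n := by exact_mod_cast harm_le h.f_le h.le_l h.lt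
    by_cases hf : L + 1 = F + n
    · have hp : (0 : ℝ) ≤ pot n F C L := by exact_mod_cast pot_nonneg h.f_le h.le_l h.lt
      by_cases hA : L = A
      · have := hitProb_of_final (i + 1) (h.final_iff.2 hf)
        rw [h.l_eq, hA] at this
        rw [this]
        have : (2 * ((i + 1 : ℕ) : ℝ)) * harm n A F C L ≤ 2 * ((i + 1 : ℕ) : ℝ) * n := by gcongr
        nlinarith [mul_nonneg (Nat.cast_nonneg (α := ℝ) n) hp]
      · have : harm n A F C L = 0 := by
          rw [harm, if_neg (by omega)]
        have := hitProb_nonneg (A : ZMod n) (i + 1) m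
        simp only [*, Int.cast_zero, mul_zero]
        positivity
    · have h1 := ih (h.step_one hf)
      have h2 := ih (h.step_neg_one hf)
      have h3 : (2 * harm n A F C L : ℝ) ≤ harm n A F (C + 1) (max L (C + 1)) +
          harm n A (min F (C - 1)) (C - 1) L := by
        exact_mod_cast two_mul_harm_le (n := n) (A := A) h.f_le h.le_l (by have := h.lt; omega)
      have h4 : (pot n F (C + 1) (max L (C + 1)) + pot n (min F (C - 1)) (C - 1) L + 4 : ℝ) =
          2 * pot n F C L := by
        exact_mod_cast pot_step (n := n) h.f_le h.le_l
      rw [hitProb_succ _ _ (mt h.final_iff.1 hf)]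
      have h5 := hitProb_nonneg (A : ZMod n) i (step m 1)
      have h6 := hitProb_nonneg (A : ZMod n) i (step m (-1))
      have h7 := mul_le_mul_of_nonneg_left h3 (Nat.cast_nonneg (α := ℝ) i)
      have h8 := congrArg (fun t : ℝ => (n : ℝ) * t) h4
      have h9 := mul_nonneg (Nat.cast_nonneg (α := ℝ) n) (add_nonneg h5 h6)
      push_cast at h7 h8 ⊢
      linarith

/-- The state in which the loop is entered. -/
def start (m : State (Ty n)) : State (Ty n)
  | .d => (0 : ℤ)
  | .c => (0 : ZMod n)
  | .f => (0 : ZMod n)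
  | .l => (0 : ZMod n)
  | .ret => m .ret

theorem expect_walk (m : State (Ty n)) (g : State (Ty n) → ℝ≥0∞) :
    ((walk n).sem m).expect g =
      (loop (guard n) (body n).sem (start m)).expect
        fun x => g (Function.update x .ret (x .l, x .l + 1)) := by
  have e : start m = Function.update (Function.update (Function.update (Function.update m
      .d (0 : ℤ)) .c (0 : ZMod n)) .f (0 : ZMod n)) .l (0 : ZMod n) := by
    funext v
    cases v <;> rfl
  rw [e]
  simp only [walk, Stmt.sem, SubDist.expect_bind, SubDist.expect_dirac]

theorem pr_walk (m : State (Ty n)) (a : ZMod n) :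
    ((walk n).sem m).pr (fun m' => m' .ret = (a, a + 1)) =
      (loop (guard n) (body n).sem (start m)).expect fun x => if x .l = a then 1 else 0 := by
  classical
  rw [SubDist.pr_eq_expect, expect_walk]
  congr 1
  funext x
  by_cases hx : x .l = a <;> simp [hx]

theorem inv_le_pr_walk (hn : 0 < n) (m : State (Ty n)) (a : ZMod n) :
    (n : ℝ≥0∞)⁻¹ ≤ ((walk n).sem m).pr fun m' => m' .ret = (a, a + 1) := by
  have : NeZero n := ⟨hn.ne'⟩
  rw [pr_walk]
  set p := (loop (guard n) (body n).sem (start m)).expect fun x => if x .l = a then 1 else 0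
    with hp
  have hpt : p ≠ ⊤ := expect_eq_ne_top a _
  have hle : ∀ i, hitProb a i (start m) ≤ p.toReal := fun i =>
    ENNReal.toReal_mono hpt (SubDist.expect_le_expect_limit _ _ _ i)
  have hlift : Lift (start m) 0 0 0 :=
    ⟨by simp [start], by simp [start], by simp [start], le_rfl, le_rfl, by omega⟩
  have hA : ((a.val : ℤ) : ZMod n) = a := by simp
  have hlt := ZMod.val_lt a
  have hh : harm n a.val 0 0 0 = 1 := by
    unfold harm
    split_ifs <;> omega
  have hn' : (0 : ℝ) < n := by exact_mod_cast hn
  have key : 1 ≤ n * p.toReal := by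
    by_contra! hlt'
    obtain ⟨i, hi⟩ := exists_nat_gt ((n * (pot n 0 0 0 : ℝ)) / (2 * (1 - n * p.toReal)))
    rw [div_lt_iff₀ (by linarith)] at hi
    have h1 := harm_le_hitProb a.val i hlift
    rw [hh, hA] at h1
    have h2 := mul_le_mul_of_nonneg_left (hle i) (by positivity : (0 : ℝ) ≤ 2 * i * n)
    push_cast at h1
    linarith
  rw [← ENNReal.ofReal_toReal hpt, ← ENNReal.ofReal_natCast, ← ENNReal.ofReal_inv_of_pos hn']
  refine ENNReal.ofReal_le_ofReal ?_
  rwa [inv_le_iff_one_le_mul₀' hn']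

theorem sum_pr_walk_le [NeZero n] (m : State (Ty n)) :
    ∑ a : ZMod n, ((walk n).sem m).pr (fun m' => m' .ret = (a, a + 1)) ≤
      ((walk n).sem m).weight := by
  classical
  simp only [SubDist.pr_eq_expect, SubDist.expect]
  rw [← Summable.tsum_finsetSum fun _ _ => ENNReal.summable, SubDist.weight]
  refine ENNReal.tsum_le_tsum fun x => ?_
  rw [← Finset.mul_sum]
  refine mul_le_of_le_one_right' ?_
  calc _ ≤ ∑ a : ZMod n, if (x .ret).1 = a then (1 : ℝ≥0∞) else 0 :=
        Finset.sum_le_sum fun a _ => by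
          by_cases h : x .ret = (a, a + 1) <;> simp [h]
    _ ≤ 1 := by simp

theorem sum_inv_natCast [NeZero n] : ∑ _a : ZMod n, (n : ℝ≥0∞)⁻¹ = 1 := by
  simp [ZMod.card, ENNReal.mul_inv_cancel, NeZero.ne n]

theorem lossless_walk (hn : 0 < n) : (walk n).Lossless := by
  have : NeZero n := ⟨hn.ne'⟩
  intro m
  refine le_antisymm (SubDist.tsum_mass_le_one _) ?_
  rw [← sum_inv_natCast (n := n)]
  exact (Finset.sum_le_sum fun a _ => inv_le_pr_walk hn m a).trans (sum_pr_walk_le m)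

theorem pr_walk_eq (hn : 0 < n) (m : State (Ty n)) (a : ZMod n) :
    ((walk n).sem m).pr (fun m' => m' .ret = (a, a + 1)) = (n : ℝ≥0∞)⁻¹ := by
  have : NeZero n := ⟨hn.ne'⟩
  refine le_antisymm ?_ (inv_le_pr_walk hn m a)
  have h := (sum_pr_walk_le m).trans (SubDist.tsum_mass_le_one _)
  rw [← sum_inv_natCast (n := n), ← Finset.add_sum_erase _ _ (Finset.mem_univ a),
    ← Finset.add_sum_erase _ _ (Finset.mem_univ a)] at h
  have hfin : ∑ _b ∈ Finset.univ.erase a, (n : ℝ≥0∞)⁻¹ ≠ ⊤ := by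
    simp [ENNReal.mul_eq_top, hn.ne']
  refine (ENNReal.add_le_add_iff_right hfin).1 (le_trans ?_ h)
  gcongr with b _
  exact inv_le_pr_walk hn m b

end CyclicWalk

theorem mainTheorem5 (n : ℕ) (hn : 0 < n) :
    (∀ a b : ZMod n,
      PWhile.ValidJudgment (CyclicWalk.walk n) (CyclicWalk.walk n)
        (fun _ _ => True)
        (fun m₁ m₂ =>
          m₁ CyclicWalk.Var.ret = (a, a + 1) ↔ m₂ CyclicWalk.Var.ret = (b, b + 1))) ∧
    (CyclicWalk.walk n).Lossless ∧
    (∀ (m : PWhile.State (CyclicWalk.Ty n)) (a : ZMod n),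
      ((CyclicWalk.walk n).sem m).pr
        (fun m' => m' CyclicWalk.Var.ret = (a, a + 1)) = (n : ℝ≥0∞)⁻¹) := by
  refine ⟨fun a b m₁ m₂ _ => ?_, CyclicWalk.lossless_walk hn, CyclicWalk.pr_walk_eq hn⟩
  exact PWhile.SubDist.coupled_iff_of_pr_eq _ _ _ _ (CyclicWalk.lossless_walk hn m₁)
    (CyclicWalk.lossless_walk hn m₂)
    ((CyclicWalk.pr_walk_eq hn m₁ a).trans (CyclicWalk.pr_walk_eq hn m₂ b).symm)
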